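/- Let $G$ be a connected Lie group modelled on a Hausdorff locally convex real vector space (smoothness in the sense of Michal–Bastiani calculus), with Lie algebra $\mathfrak g=T_{\mathbf 1}G$, adjoint action $\mathrm{Ad}$ on $\mathfrak g$ and coadjoint action $\mathrm{Ad}^*_g\lambda=\lambda\circ\mathrm{Ad}_{g^{-1}}$ on the topological dual $\mathfrak g'$; a subset of $\mathfrak g$ (resp. $\mathfrak g'$) is called invariant if it is invariant under $\mathrm{Ad}(G)$ (resp. $\mathrm{Ad}^*(G)$). Let $\mathfrak t\subseteq\mathfrak g$ be an elliptic Cartan subalgebra. That is, $\mathfrak t$ is a maximal abelian subalgebra; the spaces $\mathfrak g_{\mathbb C}^\alpha=\{x\in\mathfrak g_{\mathbb C} : [h,x]=\alpha(h)x \text{ for all } h\in\mathfrak t_{\mathbb C}\}$, where $\alpha$ runs over all complex linear functionals on $\mathfrak t_{\mathbb C}$ (including $\alpha=0$), span a dense subspace of $\mathfrak g_{\mathbb C}$; and $\alpha(\mathfrak t)\subseteq i\mathbb R$ for every $\alpha\neq 0$ with $\mathfrak g_{\mathbb C}^\alpha\neq\{0\}$. Suppose that $p_{\mathfrak t}:\mathfrak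 g\to\mathfrak t$ is a continuous linear projection onto $\mathfrak t$ that is $\mathfrak t$-equivariant, i.e. $p_{\mathfrak t}([h,x])=[h,p_{\mathfrak t}(x)]$ for $h\in\mathfrak t$, $x\in\mathfrak g$. Identify $\mathfrak t'$ with the subspace $(\ker p_{\mathfrak t})^\perp\subseteq\mathfrak g'$ via $\mu\mapsto\mu\circ p_{\mathfrak t}$, and let $p_{\mathfrak t'}:\mathfrak g'\to\mathfrak t'$, $\lambda\mapsto\lambda|_{\mathfrak t}$, be the restriction map. Then: (i) If $C\subseteq\mathfrak g$ is open, invariant and convex, then $p_{\mathfrak t}(C)=C\cap\mathfrak t$. (ii) If $C\subseteq\mathfrak g'$ is semi-equicontinuous (its support functional $s_C(v)=\sup\{\lambda(v):\lambda\in C\}$ is bounded on some non-empty open subset of $\mathfrak g$), weak-$*$-closed, invariant and convex, then $p_{\mathfrak t'}(C)=C\cap\mathfrak t'$. -/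

import Mathlib

open Filter Topology

noncomputable section

namespace LCLie

universe u v w

/-! ### Smooth maps between locally convex spaces (Michal-Bastiani calculus) -/

section Calculus

variable {E : Type u} [AddCommGroup E] [Module ℝ E] [TopologicalSpace E]
  {F : Type v} [AddCommGroup F] [Module ℝ F] [TopologicalSpace F]

/-- `A` is the derivative of `f` at `x`: for every direction `v`, the difference quotients
`t⁻¹ (f (x + t v) - f x)` converge to `A v` for `t → 0`, `t ≠ 0`. -/
def HasDerivLC (f : E → F) (A : E →L[ℝ] F) (x : E) : Prop :=
  ∀ v : E, Tendsto (fun t : ℝ => t⁻¹ • (f (x + t • v) - f x)) (𝓝[≠] 0) (𝓝 (A v))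

open scoped Classical in
/-- The derivative of `f` at `x`, and `0` if `f` has no derivative at `x`. -/
def derivLC (f : E → F) (x : E) : E →L[ℝ] F :=
  if h : ∃ A : E →L[ℝ] F, HasDerivLC f A x then h.choose else 0

end Calculus

/-- `f` is of class `C^n` on the (open) set `U` in the sense of Michal-Bastiani: `f` is continuous
on `U` and, for `n = k + 1`, it has a derivative at every point of `U` and the map
`(x, v) ↦ df(x)(v)` is of class `C^k` on `U × E`. -/
def ContDiffLC : ℕ → ∀ {E : Type u} [AddCommGroup E] [Module ℝ E] [TopologicalSpace E]
    {F : Type v} [AddCommGroup F] [Module ℝ F] [TopologicalSpace F],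
    (E → F) → Set E → Prop
  | 0, _, _, _, _, _, _, _, _, f, U => ContinuousOn f U
  | k + 1, E, _, _, _, F, _, _, _, f, U =>
      ContinuousOn f U ∧
        ∃ D : E → E →L[ℝ] F, (∀ x ∈ U, HasDerivLC f (D x) x) ∧
          ContDiffLC k (fun q : E × E => D q.1 q.2) (U ×ˢ (Set.univ : Set E))

/-- `f` is smooth on the (open) set `U`. -/
def SmoothLC {E : Type u} [AddCommGroup E] [Module ℝ E] [TopologicalSpace E]
    {F : Type v} [AddCommGroup F] [Module ℝ F] [TopologicalSpace F]
    (f : E → F) (U : Set E) : Prop :=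
  ∀ n : ℕ, ContDiffLC n f U

/-! ### Locally convex Lie groups -/

/-- `G`, a topological group with an atlas of charts with values in `E`, is a Lie group modelled on
`E` (to be used for a Hausdorff locally convex space `E`): all changes of charts are smooth, and
the multiplication and the inversion are smooth in all charts. -/
class LCLieGroup (E : Type u) [AddCommGroup E] [Module ℝ E] [TopologicalSpace E]
    (G : Type w) [Group G] [TopologicalSpace G] [ChartedSpace E G] : Prop
    extends IsTopologicalGroup G where
  smooth_coordChange : ∀ e ∈ atlas E G, ∀ e' ∈ atlas E G,
    SmoothLC (fun x : E => e' (e.symm x)) {x | x ∈ e.target ∧ e.symm x ∈ e'.source}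
  smooth_mul : ∀ e₁ ∈ atlas E G, ∀ e₂ ∈ atlas E G, ∀ e₃ ∈ atlas E G,
    SmoothLC (fun q : E × E => e₃ (e₁.symm q.1 * e₂.symm q.2))
      {q | q.1 ∈ e₁.target ∧ q.2 ∈ e₂.target ∧ e₁.symm q.1 * e₂.symm q.2 ∈ e₃.source}
  smooth_inv : ∀ e ∈ atlas E G, ∀ e' ∈ atlas E G,
    SmoothLC (fun x : E => e' (e.symm x)⁻¹) {x | x ∈ e.target ∧ (e.symm x)⁻¹ ∈ e'.source}

section LieAlgebra

variable {E : Type u} [AddCommGroup E] [Module ℝ E] [TopologicalSpace E]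
  (G : Type w) [Group G] [TopologicalSpace G] [ChartedSpace E G]

/-! The Lie algebra `𝔤 = T_1 G` of `G` is the model space `E`: the preferred chart `φ` at `1`
identifies `T_1 G` with `E`. -/

/-- The adjoint representation of `G` on `𝔤 = E`: `Ad(g)` is the derivative at `1` of the
conjugation `c_g(h) = g h g⁻¹`, computed in the chart `φ` at `1`. -/
def Ad {G : Type w} [Group G] [TopologicalSpace G] [ChartedSpace E G] (g : G) : E →L[ℝ] E :=
  derivLC (fun x : E => chartAt E (1 : G) (g * (chartAt E (1 : G)).symm x * g⁻¹))
    (chartAt E (1 : G) 1)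

/-- The Lie bracket of `𝔤 = E`, given by `[x, y] = ad(x) y`, where `ad` is the derivative at `1`
of the adjoint representation: `[x, y]` is the derivative at `1`, in the direction of `x`, of the
map `g ↦ Ad(g) y`, computed in the chart `φ` at `1`. -/
def lieBr (x y : E) : E :=
  derivLC (fun u : E => Ad ((chartAt E (1 : G)).symm u) y) (chartAt E (1 : G) 1) x

end LieAlgebra

/-! ### Complexification -/

/-- The complexification `E_ℂ = E ⊕ iE` of a real vector space; the pair `(x, y)` is `x + iy`. -/
def Cplx (E : Type u) : Type u := E × E

namespace Cplx

set_option linter.unusedSectionVars false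

variable {E : Type u} [AddCommGroup E] [Module ℝ E]

instance : AddCommGroup (Cplx E) := inferInstanceAs (AddCommGroup (E × E))

instance [TopologicalSpace E] : TopologicalSpace (Cplx E) :=
  inferInstanceAs (TopologicalSpace (E × E))

/-- The element `x + iy` of the complexification. -/
def mk (x y : E) : Cplx E := ((x, y) : E × E)

/-- The real part. -/
def re (z : Cplx E) : E := Prod.fst (show E × E from z)

/-- The imaginary part. -/
def im (z : Cplx E) : E := Prod.snd (show E × E from z)

@[ext] theorem ext {z z' : Cplx E} (h₁ : z.re = z'.re) (h₂ : z.im = z'.im) : z = z' :=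
  Prod.ext h₁ h₂

@[simp] theorem re_mk (x y : E) : (mk x y).re = x := rfl
@[simp] theorem im_mk (x y : E) : (mk x y).im = y := rfl
@[simp] theorem re_add (z z' : Cplx E) : (z + z').re = z.re + z'.re := rfl
@[simp] theorem im_add (z z' : Cplx E) : (z + z').im = z.im + z'.im := rfl
@[simp] theorem re_zero : (0 : Cplx E).re = 0 := rfl
@[simp] theorem im_zero : (0 : Cplx E).im = 0 := rfl

instance : SMul ℂ (Cplx E) :=
  ⟨fun c z => mk (c.re • z.re - c.im • z.im) (c.re • z.im + c.im • z.re)⟩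

@[simp] theorem re_smul (c : ℂ) (z : Cplx E) : (c • z).re = c.re • z.re - c.im • z.im := rfl
@[simp] theorem im_smul (c : ℂ) (z : Cplx E) : (c • z).im = c.re • z.im + c.im • z.re := rfl

instance : Module ℂ (Cplx E) where
  one_smul z := by ext <;> simp
  mul_smul c d z := by ext <;> simp <;> module
  smul_zero c := by ext <;> simp
  smul_add c z z' := by ext <;> simp <;> module
  add_smul c d z := by ext <;> simp <;> module
  zero_smul z := by ext <;> simp

end Cplx

/-- The complexification `𝔱_ℂ = 𝔱 ⊕ i𝔱 ⊆ E_ℂ` of a real subspace `𝔱 ⊆ E`. -/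
def cplxSub {E : Type u} [AddCommGroup E] [Module ℝ E] (t : Submodule ℝ E) :
    Submodule ℂ (Cplx E) where
  carrier := {z | z.re ∈ t ∧ z.im ∈ t}
  add_mem' ha hb := ⟨t.add_mem ha.1 hb.1, t.add_mem ha.2 hb.2⟩
  zero_mem' := ⟨t.zero_mem, t.zero_mem⟩
  smul_mem' c _ hz := ⟨t.sub_mem (t.smul_mem c.re hz.1) (t.smul_mem c.im hz.2),
    t.add_mem (t.smul_mem c.re hz.2) (t.smul_mem c.im hz.1)⟩

/-! ### Root decompositions -/

section Roots

variable {E : Type u} [AddCommGroup E] [Module ℝ E] [TopologicalSpace E]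
  (G : Type w) [Group G] [TopologicalSpace G] [ChartedSpace E G]

/-- The complex bilinear extension of the Lie bracket to `𝔤_ℂ`. -/
def lieBrC (z z' : Cplx E) : Cplx E :=
  Cplx.mk (lieBr G z.re z'.re - lieBr G z.im z'.im) (lieBr G z.re z'.im + lieBr G z.im z'.re)

/-- `𝔤_ℂ^α = {z ∈ 𝔤_ℂ | [h, z] = α(h) z for all h ∈ 𝔱_ℂ}`, for a linear functional `α` on
`𝔱_ℂ`. -/
def rootSpace (t : Submodule ℝ E) (α : cplxSub t →ₗ[ℂ] ℂ) : Set (Cplx E) :=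
  {z | ∀ h : cplxSub t, lieBrC G (h : Cplx E) z = α h • z}

/-- `α` is a root if it is nonzero and its root space is nonzero. -/
def IsRoot (t : Submodule ℝ E) (α : cplxSub t →ₗ[ℂ] ℂ) : Prop :=
  α ≠ 0 ∧ ∃ z ∈ rootSpace G t α, z ≠ 0

/-- An abelian subalgebra of `𝔤`. -/
def IsAbelianSubalgebra (t : Submodule ℝ E) : Prop :=
  ∀ x ∈ t, ∀ y ∈ t, lieBr G x y = 0

/-- `𝔱` is an elliptic Cartan subalgebra of `𝔤`: it is maximal abelian, the sum of the spaces
`𝔤_ℂ^α` (including `α = 0`) is dense in `𝔤_ℂ`, and all roots are purely imaginary on `𝔱`. -/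
structure IsEllipticCartan (t : Submodule ℝ E) : Prop where
  maximal_abelian : Maximal (IsAbelianSubalgebra G) t
  dense_span : Dense
    (Submodule.span ℂ (⋃ α : cplxSub t →ₗ[ℂ] ℂ, rootSpace G t α) : Set (Cplx E))
  root_imaginary : ∀ α : cplxSub t →ₗ[ℂ] ℂ, IsRoot G t α →
    ∀ h : cplxSub t, (h : Cplx E).im = 0 → (α h).re = 0

end Roots

/-! ### Invariant subsets of `𝔤` and of its topological dual `𝔤'` -/

section Invariance

variable {E : Type u} [AddCommGroup E] [Module ℝ E] [TopologicalSpace E]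
  (G : Type w) [Group G] [TopologicalSpace G] [ChartedSpace E G]

/-- A subset of `𝔤` that is invariant under the adjoint action. -/
def AdInvariant (C : Set E) : Prop :=
  ∀ g : G, ∀ x ∈ C, Ad g x ∈ C

/-- The adjoint `l ↦ l ∘ A` of a continuous linear map `A`, on the topological duals. -/
def dualMap {F : Type v} [AddCommGroup F] [Module ℝ F] [TopologicalSpace F] (A : E →L[ℝ] F)
    (l : WeakDual ℝ F) : WeakDual ℝ E :=
  StrongDual.toWeakDual ((WeakDual.toStrongDual l).comp A)

/-- A subset of `𝔤'` that is invariant under the coadjoint action `Ad*(g) l = l ∘ Ad(g⁻¹)`. -/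
def CoadInvariant (C : Set (WeakDual ℝ E)) : Prop :=
  ∀ g : G, ∀ l ∈ C, dualMap (Ad g⁻¹) l ∈ C

/-- The support functional `s_C(v) = sup ⟨C, v⟩` of a subset `C` of the dual. -/
def supportFn (C : Set (WeakDual ℝ E)) (v : E) : EReal :=
  ⨆ l ∈ C, ((l v : ℝ) : EReal)

/-- `C` is semi-equicontinuous: its support functional is bounded on some nonempty open set.
An upper bound is enough: if `l ∈ C`, then `s_C` is bounded below by the continuous functional `l`,
hence locally bounded below. -/
def SemiEquicontinuous (C : Set (WeakDual ℝ E)) : Prop :=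
  ∃ U : Set E, IsOpen U ∧ U.Nonempty ∧ ∃ M : ℝ, ∀ v ∈ U, supportFn C v ≤ (M : EReal)

end Invariance

end LCLie

end

/-!
The group is not assumed to have an exponential function, so one cannot average over the flows
`exp (s ad h)` with `h ∈ 𝔱`. Invariance enters only infinitesimally: if a continuous functional `l`
supports an invariant convex set at a point `y` of its closure, then `l (Ad(g) y)` is maximal at
`g = 1`, and hence `l ([h, y]) = 0` for all `h` (`apply_lieBr_eq_zero`).

Let `O` be open and convex with invariant closure, and let `x ∈ O` be the real part of a finite sum
of root vectors. Then `x = z + x₁` with `z = p x ∈ 𝔱`, and `x₁` lies in a finite sum of planes, on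
which a regular element `h ∈ 𝔱` acts by infinitesimal rotations. Pull `O` back to an open convex
subset `A` of the Euclidean space of these planes, with `z` at the origin, and let `J` be the
skew-symmetric invertible operator given by `ad h`. The infinitesimal invariance says that a normal
vector `n` of `A` at `y` is orthogonal to `J y`, and it has to be shown that `0 ∈ A` as soon as some
`J w` lies in `A`. If `τ w ∉ A` for a small `τ ≠ 0`, take a nearest point `y` of the closure and the
outward normal `n`, so that `τ w = y + r n` with `r ≥ 0`. As `J` is skew, `⟪n, J (τ w)⟫ = 0`, so the
normal `n` is orthogonal to the interior point `J w`; but the supporting hyperplane at `y` is within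
distance `|τ| ‖w‖` of the origin, which is impossible for small `τ`. Hence `±τ w ∈ A`, and `0 ∈ A` by
convexity (`zero_mem_of_skew_tangent`, `mem_of_add_sum_mem`). The density of the sum of the root
spaces extends `p x ∈ O` to all `x ∈ O` (`map_mem_of_mem`), which is the statement on subsets of `𝔤`.

For `C ⊆ 𝔤'`, the same is applied to the interiors of the sublevel sets of the support functional
of `C`. This shows that the support functional does not increase under `p`, and the separation
theorem for the weak-* topology gives `l ∘ p ∈ C` for all `l ∈ C`.

The argument needs that the bracket is the derivative of the adjoint action, bilinear and
antisymmetric (the latter to see that the centralizer of `𝔱` is `𝔱`). These facts are derived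
from a chain rule along curves (`tendsto_slope_comp`) and from the symmetry of second derivatives
(`second_deriv_symm`) in Michal-Bastiani calculus.
-/

namespace LCLie

/-! ### Michal-Bastiani calculus -/

section MichalBastiani

variable {X : Type*} [AddCommGroup X] [Module ℝ X] [TopologicalSpace X]
  {Y : Type*} [AddCommGroup Y] [Module ℝ Y] [TopologicalSpace Y]

theorem HasDerivLC.unique [T2Space Y] {f : X → Y} {A B : X →L[ℝ] Y} {x : X}
    (hA : HasDerivLC f A x) (hB : HasDerivLC f B x) : A = B :=
  ContinuousLinearMap.ext fun v => tendsto_nhds_unique (hA v) (hB v)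

theorem HasDerivLC.derivLC_eq [T2Space Y] {f : X → Y} {A : X →L[ℝ] Y} {x : X}
    (h : HasDerivLC f A x) : derivLC f x = A := by
  have hex : ∃ A : X →L[ℝ] Y, HasDerivLC f A x := ⟨A, h⟩
  rw [derivLC, dif_pos hex]
  exact hex.choose_spec.unique h

theorem tendsto_add_smul_nhds_zero [ContinuousAdd X] [ContinuousSMul ℝ X] (x v : X) :
    Tendsto (fun s : ℝ => x + s • v) (𝓝 0) (𝓝 x) := by
  have : Continuous fun s : ℝ => x + s • v := by fun_prop
  simpa using this.tendsto 0

theorem HasDerivLC.congr [ContinuousAdd X] [ContinuousSMul ℝ X] {f g : X → Y}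
    {A : X →L[ℝ] Y} {x : X} (h : HasDerivLC f A x) (hfg : ∀ᶠ y in 𝓝 x, g y = f y) :
    HasDerivLC g A x := fun v => by
  refine (h v).congr' ?_
  have := ((tendsto_add_smul_nhds_zero x v).eventually hfg).filter_mono
    (nhdsWithin_le_nhds (s := {0}ᶜ))
  filter_upwards [this] with s hs
  rw [hs, hfg.self_of_nhds]

theorem HasDerivLC.hasDerivAt_comp_line {f : X → Y} {A : X →L[ℝ] Y} {x w : X} {τ : ℝ}
    (h : HasDerivLC f A (x + τ • w)) (l : Y →L[ℝ] ℝ) :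
    HasDerivAt (fun s : ℝ => l (f (x + s • w))) (l (A w)) τ := by
  rw [hasDerivAt_iff_tendsto_slope_zero]
  refine ((l.continuous.tendsto _).comp (h w)).congr fun s => ?_
  simp only [Function.comp, map_smul, map_sub, add_smul, add_assoc]

/-- Chain rule along curves: if `f` is of class `C¹` on the open set `U` and the curve `γ` passes
through `x ∈ U` with velocity `v`, then `f ∘ γ` has velocity `df(x)(v)`. -/
theorem tendsto_slope_comp [IsTopologicalAddGroup X] [ContinuousSMul ℝ X]
    [IsTopologicalAddGroup Y] [ContinuousSMul ℝ Y] [LocallyConvexSpace ℝ Y]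
    {f : X → Y} {D : X → X →L[ℝ] Y} {U : Set X} (hU : IsOpen U)
    (hD : ∀ x ∈ U, HasDerivLC f (D x) x)
    (hc : ContinuousOn (fun q : X × X => D q.1 q.2) (U ×ˢ Set.univ))
    {γ : ℝ → X} {x v : X} (hx : x ∈ U)
    (hγ : Tendsto (fun s : ℝ => s⁻¹ • (γ s - x)) (𝓝[≠] 0) (𝓝 v)) :
    Tendsto (fun s : ℝ => s⁻¹ • (f (γ s) - f x)) (𝓝[≠] 0) (𝓝 (D x v)) := by
  rw [tendsto_iff_forall_eventually_mem]
  intro W' hW'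
  obtain ⟨W, ⟨hW0, hWo, hWc⟩, hWW'⟩ : ∃ W : Set Y, (D x v ∈ W ∧ IsOpen W ∧ Convex ℝ W) ∧
      W ⊆ W' := by
    have h0 : (fun y => D x v + y) ⁻¹' W' ∈ 𝓝 (0 : Y) := by
      refine (continuous_const_add (D x v)).continuousAt.preimage_mem_nhds ?_
      simpa using hW'
    obtain ⟨V, ⟨hV0, hVo, hVc⟩, hV⟩ :=
      (LocallyConvexSpace.convex_open_basis_zero ℝ Y).mem_iff.1 h0
    refine ⟨(fun y => -(D x v) + y) ⁻¹' V, ⟨by simpa using hV0,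
      hVo.preimage (continuous_const_add _), hVc.translate_preimage_right _⟩, fun y hy => ?_⟩
    simpa using hV hy
  -- For small `r` and `q` near `v`, the point `x + r q` lies in `U` and `D (x + r q) q` in `W`.
  have hN : ∀ᶠ rq : ℝ × X in 𝓝 (0, v), x + rq.1 • rq.2 ∈ U ∧ D (x + rq.1 • rq.2) rq.2 ∈ W := by
    have hΦ : Tendsto (fun rq : ℝ × X => (x + rq.1 • rq.2, rq.2)) (𝓝 (0, v)) (𝓝 (x, v)) := by
      have : Continuous fun rq : ℝ × X => (x + rq.1 • rq.2, rq.2) := by fun_prop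
      simpa using this.tendsto (0, v)
    have hU' : U ×ˢ (Set.univ : Set X) ∈ 𝓝 (x, v) :=
      (hU.prod isOpen_univ).mem_nhds ⟨hx, trivial⟩
    have h2 := (hc.continuousAt hU').tendsto.eventually (hWo.mem_nhds hW0)
    filter_upwards [hΦ.eventually hU', hΦ.eventually h2] with rq h h'
    exact ⟨h.1, h'⟩
  rw [nhds_prod_eq] at hN
  obtain ⟨p, hp, q, hq, hpq⟩ := eventually_prod_iff.1 hN
  obtain ⟨δ, hδ, hδp⟩ := Metric.eventually_nhds_iff.1 hp
  have hsmall : ∀ᶠ s : ℝ in 𝓝[≠] 0, |s| < δ := by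
    refine nhdsWithin_le_nhds (Metric.eventually_nhds_iff.2 ⟨δ, hδ, fun y hy => ?_⟩)
    simpa using hy
  filter_upwards [hsmall, hγ.eventually hq, self_mem_nhdsWithin] with s hs hqs hs0
  refine hWW' ?_
  by_contra hP
  set w := s⁻¹ • (γ s - x) with hw
  have hγs : γ s = x + s • w := by rw [hw, smul_inv_smul₀ hs0]; abel
  obtain ⟨l, hl⟩ := geometric_hahn_banach_open_point hWc hWo hP
  have hmem : ∀ τ ∈ Set.Icc (0 : ℝ) 1, x + τ • s • w ∈ U ∧ D (x + τ • s • w) w ∈ W := by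
    intro τ hτ
    have : dist (τ * s) 0 < δ := by
      rw [Real.dist_eq, sub_zero, abs_mul, abs_of_nonneg hτ.1]
      nlinarith [hτ.2, abs_nonneg s]
    simpa [mul_smul] using hpq (hδp this) hqs
  have hder : ∀ τ ∈ Set.Icc (0 : ℝ) 1,
      HasDerivAt (fun τ : ℝ => l (f (x + τ • s • w))) (l (D (x + τ • s • w) (s • w))) τ :=
    fun τ hτ => (hD _ (hmem τ hτ).1).hasDerivAt_comp_line l
  obtain ⟨τ, hτ, hτ'⟩ := exists_hasDerivAt_eq_slope _ _ zero_lt_one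
    (fun τ hτ => (hder τ hτ).continuousAt.continuousWithinAt)
    (fun τ hτ => hder τ (Set.Ioo_subset_Icc_self hτ))
  have h1 := hl _ (hmem τ (Set.Ioo_subset_Icc_self hτ)).2
  rw [hγs] at h1
  simp only [map_smul, map_sub, smul_eq_mul, one_smul, zero_smul, add_zero, sub_zero,
    div_one] at hτ' h1
  rw [← hτ', inv_mul_cancel_left₀ hs0] at h1
  exact lt_irrefl _ h1

/-- A mean value theorem for the mixed second difference of a `C²` map. -/
theorem exists_second_difference_eq
    {f : X → Y} {D : X → X →L[ℝ] Y} {D' : X × X → X × X →L[ℝ] Y} {U : Set X}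
    (hD : ∀ x ∈ U, HasDerivLC f (D x) x)
    (hD' : ∀ q ∈ U ×ˢ (Set.univ : Set X), HasDerivLC (fun q : X × X => D q.1 q.2) (D' q) q)
    (l : Y →L[ℝ] ℝ) {x w w' : X} {s : ℝ} (hs : 0 < s)
    (hx : ∀ a ∈ Set.Icc (0 : ℝ) s, ∀ b ∈ Set.Icc (0 : ℝ) s, x + a • w + b • w' ∈ U) :
    ∃ a ∈ Set.Ioo 0 s, ∃ b ∈ Set.Ioo 0 s,
      l (f (x + s • w + s • w')) - l (f (x + s • w)) - l (f (x + s • w')) + l (f x) =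
        s * (s * l (D' (x + a • w + b • w', w) (w', 0))) := by
  have hs' := hs.le
  have h1 : ∀ a ∈ Set.Icc (0 : ℝ) s, HasDerivAt
      (fun a : ℝ => l (f ((x + s • w') + a • w)) - l (f (x + a • w)))
      (l (D ((x + s • w') + a • w) w) - l (D (x + a • w) w)) a := by
    intro a ha
    refine ((hD _ ?_).hasDerivAt_comp_line l).sub ((hD _ ?_).hasDerivAt_comp_line l)
    · rw [add_right_comm]; exact hx a ha s ⟨hs', le_rfl⟩
    · simpa using hx a ha 0 ⟨le_rfl, hs'⟩
  obtain ⟨a, ha, ha'⟩ := exists_hasDerivAt_eq_slope _ _ hs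
    (fun a ha => (h1 a ha).continuousAt.continuousWithinAt)
    (fun a ha => h1 a (Set.Ioo_subset_Icc_self ha))
  have h2 : ∀ b ∈ Set.Icc (0 : ℝ) s, HasDerivAt (fun b : ℝ => l (D (x + a • w + b • w') w))
      (l (D' (x + a • w + b • w', w) (w', 0))) b := by
    intro b hb
    have := (hD' (x + a • w + b • w', w)
      ⟨hx a (Set.Ioo_subset_Icc_self ha) b hb, trivial⟩)
    have e : ∀ b : ℝ, (x + a • w + b • w', w) = (x + a • w, w) + b • ((w', 0) : X × X) := by
      intro b; ext <;> simp
    rw [e b] at this ⊢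
    simpa using this.hasDerivAt_comp_line l
  obtain ⟨b, hb, hb'⟩ := exists_hasDerivAt_eq_slope _ _ hs
    (fun a ha => (h2 a ha).continuousAt.continuousWithinAt)
    (fun a ha => h2 a (Set.Ioo_subset_Icc_self ha))
  refine ⟨a, ha, b, hb, ?_⟩
  rw [eq_div_iff (by linarith)] at ha' hb'
  simp only [zero_smul, add_zero, sub_zero] at ha' hb'
  rw [mul_comm s (l _), hb', mul_comm s, add_right_comm x (a • w), ha',
    add_right_comm x (s • w) (s • w')]
  ring

/-- The second derivative of a `C²` map is symmetric. -/
theorem second_deriv_symm [IsTopologicalAddGroup X] [ContinuousSMul ℝ X]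
    [IsTopologicalAddGroup Y] [ContinuousSMul ℝ Y] [LocallyConvexSpace ℝ Y] [T2Space Y]
    {f : X → Y} {D : X → X →L[ℝ] Y} {D' : X × X → X × X →L[ℝ] Y} {U : Set X} (hU : IsOpen U)
    (hD : ∀ x ∈ U, HasDerivLC f (D x) x)
    (hD' : ∀ q ∈ U ×ˢ (Set.univ : Set X), HasDerivLC (fun q : X × X => D q.1 q.2) (D' q) q)
    (hc : ContinuousOn (fun r : (X × X) × (X × X) => D' r.1 r.2)
      ((U ×ˢ (Set.univ : Set X)) ×ˢ Set.univ))
    {x : X} (hx : x ∈ U) (w w' : X) : D' (x, w) (w', 0) = D' (x, w') (w, 0) := by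
  by_contra hne
  obtain ⟨l, hl⟩ := geometric_hahn_banach_point_point hne
  have hcont : ∀ w w' : X, Tendsto (fun ab : ℝ × ℝ =>
      l (D' (x + ab.1 • w + ab.2 • w', w) (w', 0))) (𝓝 (0, 0)) (𝓝 (l (D' (x, w) (w', 0)))) := by
    intro w w'
    refine (l.continuous.tendsto _).comp ?_
    have h1 := (hc.continuousAt (((hU.prod isOpen_univ).prod isOpen_univ).mem_nhds
      (show ((x, w), ((w', 0) : X × X)) ∈ (U ×ˢ (Set.univ : Set X)) ×ˢ Set.univ from
        ⟨⟨hx, trivial⟩, trivial⟩))).tendsto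
    have h2 : Continuous fun ab : ℝ × ℝ =>
        ((x + ab.1 • w + ab.2 • w', w), ((w', 0) : X × X)) := by fun_prop
    have h3 := h2.tendsto (0, 0)
    simp only [zero_smul, add_zero] at h3
    exact h1.comp h3
  have hUev : Tendsto (fun ab : ℝ × ℝ => x + ab.1 • w + ab.2 • w') (𝓝 (0, 0)) (𝓝 x) := by
    have : Continuous fun ab : ℝ × ℝ => x + ab.1 • w + ab.2 • w' := by fun_prop
    simpa using this.tendsto (0, 0)
  have hswap : Tendsto (Prod.swap : ℝ × ℝ → ℝ × ℝ) (𝓝 (0, 0)) (𝓝 (0, 0)) :=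
    continuous_swap.tendsto (0, 0)
  obtain ⟨m, hm1, hm2⟩ := exists_between hl
  have hev : ∀ᶠ ab : ℝ × ℝ in 𝓝 (0, 0), x + ab.1 • w + ab.2 • w' ∈ U ∧
      l (D' (x + ab.1 • w + ab.2 • w', w) (w', 0)) < m ∧
      m < l (D' (x + ab.1 • w' + ab.2 • w, w') (w, 0)) :=
    (hUev.eventually (hU.mem_nhds hx)).and
      (((hcont w w').eventually (gt_mem_nhds hm1)).and
        ((hcont w' w).eventually (lt_mem_nhds hm2)))
  obtain ⟨δ, hδ, hball⟩ := Metric.eventually_nhds_iff.1 hev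
  have hin : ∀ a ∈ Set.Icc (0 : ℝ) (δ / 2), ∀ b ∈ Set.Icc (0 : ℝ) (δ / 2),
      dist (a, b) ((0, 0) : ℝ × ℝ) < δ := by
    intro a ha b hb
    rw [Prod.dist_eq, Real.dist_eq, Real.dist_eq, sub_zero, sub_zero, abs_of_nonneg ha.1,
      abs_of_nonneg hb.1]
    exact max_lt (by linarith [ha.2]) (by linarith [hb.2])
  have hs : 0 < δ / 2 := by linarith
  obtain ⟨a, ha, b, hb, e1⟩ := exists_second_difference_eq hD hD' l hs
    (fun a ha b hb => (hball (hin a ha b hb)).1)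
  obtain ⟨a', ha', b', hb', e2⟩ := exists_second_difference_eq hD hD' l (w := w') (w' := w) hs
    (fun a ha b hb => by
      have := (hball (hin b hb a ha)).1
      rwa [add_right_comm] at this)
  have i1 := (hball (hin a (Set.Ioo_subset_Icc_self ha) b (Set.Ioo_subset_Icc_self hb))).2.1
  have i2 := (hball (hin a' (Set.Ioo_subset_Icc_self ha') b' (Set.Ioo_subset_Icc_self hb'))).2.2
  simp only at i1 i2
  rw [add_right_comm x] at e2
  have e3 : (δ / 2) * ((δ / 2) * l (D' (x + a • w + b • w', w) (w', 0))) =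
      (δ / 2) * ((δ / 2) * l (D' (x + a' • w' + b' • w, w') (w, 0))) := by
    rw [← e1, ← e2]; ring
  have e4 := mul_left_cancel₀ hs.ne' (mul_left_cancel₀ hs.ne' e3)
  linarith

end MichalBastiani

/-! ### The Lie bracket as the derivative of the adjoint action -/

section GroupChart

variable (E : Type*) [TopologicalSpace E]
  (G : Type*) [Group G] [TopologicalSpace G] [ChartedSpace E G]

/-- The preferred chart at the unit element. -/
abbrev oneChart : OpenPartialHomeomorph G E := chartAt E (1 : G)

/-- The coordinates of the unit element in the chart at the unit element. -/
abbrev oneCoord : E := oneChart E G 1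

/-- The domain of the multiplication in the chart at the unit element. -/
def mulDomain : Set (E × E) :=
  {q | q.1 ∈ (oneChart E G).target ∧ q.2 ∈ (oneChart E G).target ∧
    (oneChart E G).symm q.1 * (oneChart E G).symm q.2 ∈ (oneChart E G).source}

/-- The multiplication in the chart at the unit element. -/
def mulCoord (q : E × E) : E :=
  oneChart E G ((oneChart E G).symm q.1 * (oneChart E G).symm q.2)

/-- The inversion in the chart at the unit element. -/
def invCoord (x : E) : E := oneChart E G ((oneChart E G).symm x)⁻¹

variable {E G}

theorem oneCoord_mem_target : oneCoord E G ∈ (oneChart E G).target :=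
  mem_chart_target E (1 : G)

@[simp] theorem oneChart_symm_oneCoord : (oneChart E G).symm (oneCoord E G) = 1 :=
  (oneChart E G).left_inv (mem_chart_source E (1 : G))

theorem mk_oneCoord_mem_mulDomain {x : E} (hx : x ∈ (oneChart E G).target) :
    (x, oneCoord E G) ∈ mulDomain E G :=
  ⟨hx, oneCoord_mem_target, by simpa using (oneChart E G).map_target hx⟩

theorem oneCoord_mk_mem_mulDomain {x : E} (hx : x ∈ (oneChart E G).target) :
    (oneCoord E G, x) ∈ mulDomain E G :=
  ⟨oneCoord_mem_target, hx, by simpa using (oneChart E G).map_target hx⟩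

theorem mulCoord_mk_oneCoord {x : E} (hx : x ∈ (oneChart E G).target) :
    mulCoord E G (x, oneCoord E G) = x := by
  simpa [mulCoord] using (oneChart E G).right_inv hx

theorem mulCoord_oneCoord_mk {x : E} (hx : x ∈ (oneChart E G).target) :
    mulCoord E G (oneCoord E G, x) = x := by
  simpa [mulCoord] using (oneChart E G).right_inv hx

@[simp] theorem invCoord_oneCoord : invCoord E G (oneCoord E G) = oneCoord E G := by
  simp [invCoord]

theorem mk_invCoord_mem_mulDomain {x : E} (hx : x ∈ (oneChart E G).target)
    (hx' : ((oneChart E G).symm x)⁻¹ ∈ (oneChart E G).source) :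
    (x, invCoord E G x) ∈ mulDomain E G := by
  refine ⟨hx, (oneChart E G).map_source hx', ?_⟩
  simp only [invCoord, (oneChart E G).left_inv hx', mul_inv_cancel]
  exact mem_chart_source E (1 : G)

theorem mulCoord_mk_invCoord {x : E}
    (hx' : ((oneChart E G).symm x)⁻¹ ∈ (oneChart E G).source) :
    mulCoord E G (x, invCoord E G x) = oneCoord E G := by
  simp only [mulCoord, invCoord, (oneChart E G).left_inv hx', mul_inv_cancel]

theorem isOpen_mulDomain [IsTopologicalGroup G] : IsOpen (mulDomain E G) := by
  have hcont : ContinuousOn (fun q : E × E => (oneChart E G).symm q.1 * (oneChart E G).symm q.2)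
      ((oneChart E G).target ×ˢ (oneChart E G).target) :=
    ((oneChart E G).continuousOn_symm.comp continuousOn_fst fun q hq => hq.1).mul
      ((oneChart E G).continuousOn_symm.comp continuousOn_snd fun q hq => hq.2)
  have := hcont.isOpen_inter_preimage ((oneChart E G).open_target.prod (oneChart E G).open_target)
    (oneChart E G).open_source
  convert this using 1
  ext q
  simp [mulDomain, and_assoc]

theorem eventually_inv_mem_source [IsTopologicalGroup G] :
    ∀ᶠ x in 𝓝 (oneCoord E G), x ∈ (oneChart E G).target ∧
      ((oneChart E G).symm x)⁻¹ ∈ (oneChart E G).source := by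
  refine Filter.Eventually.and ((oneChart E G).open_target.mem_nhds oneCoord_mem_target) ?_
  have h := ((oneChart E G).continuousAt_symm (oneCoord_mem_target (E := E) (G := G))).inv
  refine h.eventually ((oneChart E G).open_source.mem_nhds ?_)
  simp

section Derivatives

variable [AddCommGroup E] [Module ℝ E] [IsTopologicalAddGroup E] [ContinuousSMul ℝ E]
  [T2Space E]

theorem deriv_mulCoord_left {D : E × E → E × E →L[ℝ] E}
    (hD : ∀ q ∈ mulDomain E G, HasDerivLC (mulCoord E G) (D q) q)
    {x : E} (hx : x ∈ (oneChart E G).target) (v : E) : D (x, oneCoord E G) (v, 0) = v := by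
  refine tendsto_nhds_unique (hD _ (mk_oneCoord_mem_mulDomain hx) (v, 0)) ?_
  refine Tendsto.congr' ?_ tendsto_const_nhds
  filter_upwards [nhdsWithin_le_nhds ((tendsto_add_smul_nhds_zero x v).eventually
    ((oneChart E G).open_target.mem_nhds hx)), self_mem_nhdsWithin] with s hs hs0
  have e : (x, oneCoord E G) + s • (v, (0 : E)) = (x + s • v, oneCoord E G) := by simp
  rw [e, mulCoord_mk_oneCoord hs, mulCoord_mk_oneCoord hx, add_sub_cancel_left,
    inv_smul_smul₀ hs0]

theorem deriv_mulCoord_right {D : E × E → E × E →L[ℝ] E}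
    (hD : ∀ q ∈ mulDomain E G, HasDerivLC (mulCoord E G) (D q) q)
    {x : E} (hx : x ∈ (oneChart E G).target) (v : E) : D (oneCoord E G, x) (0, v) = v := by
  refine tendsto_nhds_unique (hD _ (oneCoord_mk_mem_mulDomain hx) (0, v)) ?_
  refine Tendsto.congr' ?_ tendsto_const_nhds
  filter_upwards [nhdsWithin_le_nhds ((tendsto_add_smul_nhds_zero x v).eventually
    ((oneChart E G).open_target.mem_nhds hx)), self_mem_nhdsWithin] with s hs hs0
  have e : (oneCoord E G, x) + s • ((0 : E), v) = (oneCoord E G, x + s • v) := by simp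
  rw [e, mulCoord_oneCoord_mk hs, mulCoord_oneCoord_mk hx, add_sub_cancel_left,
    inv_smul_smul₀ hs0]

/-- The adjoint action in the chart at `1`: conjugation by `g = φ⁻¹(u)` is
`x ↦ m(m(u, x), ι(u))`, so that `Ad(g) y` is obtained by differentiating `m` twice. -/
theorem Ad_oneChart_symm_apply [LocallyConvexSpace ℝ E] [IsTopologicalGroup G]
    {D : E × E → E × E →L[ℝ] E}
    (hD : ∀ q ∈ mulDomain E G, HasDerivLC (mulCoord E G) (D q) q)
    (hc : ContinuousOn (fun r : (E × E) × (E × E) => D r.1 r.2) (mulDomain E G ×ˢ Set.univ))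
    {u : E} (hu : u ∈ (oneChart E G).target)
    (hu' : ((oneChart E G).symm u)⁻¹ ∈ (oneChart E G).source) (y : E) :
    Ad (E := E) ((oneChart E G).symm u) y =
      D (u, invCoord E G u) (D (u, oneCoord E G) (0, y), 0) := by
  have hder : HasDerivLC (fun x : E => mulCoord E G (mulCoord E G (u, x), invCoord E G u))
      ((D (u, invCoord E G u)).comp
        (((D (u, oneCoord E G)).comp (ContinuousLinearMap.inr ℝ E E)).prod 0))
      (oneCoord E G) := by
    intro v
    have hγ : Tendsto (fun s : ℝ => s⁻¹ • ((mulCoord E G (u, oneCoord E G + s • v),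
        invCoord E G u) - (u, invCoord E G u))) (𝓝[≠] 0)
        (𝓝 (D (u, oneCoord E G) (0, v), (0 : E))) := by
      have h1 := hD _ (mk_oneCoord_mem_mulDomain hu) (0, v)
      have h2 := h1.prodMk_nhds (tendsto_const_nhds (x := (0 : E)))
      refine h2.congr fun s => ?_
      simp [mulCoord_mk_oneCoord hu]
    have := tendsto_slope_comp isOpen_mulDomain hD hc (mk_invCoord_mem_mulDomain hu hu') hγ
    simpa [mulCoord_mk_oneCoord hu] using this
  have hcongr : ∀ᶠ x in 𝓝 (oneCoord E G),
      oneChart E G ((oneChart E G).symm u * (oneChart E G).symm x *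
        ((oneChart E G).symm u)⁻¹) =
      mulCoord E G (mulCoord E G (u, x), invCoord E G u) := by
    have hev : ∀ᶠ x in 𝓝 (oneCoord E G), (u, x) ∈ mulDomain E G :=
      (Continuous.prodMk_right u).continuousAt.eventually
        (isOpen_mulDomain.mem_nhds (mk_oneCoord_mem_mulDomain hu))
    filter_upwards [hev] with x hx
    simp only [mulCoord, invCoord, (oneChart E G).left_inv hu', (oneChart E G).left_inv hx.2.2]
  have := (hder.congr hcongr).derivLC_eq
  rw [Ad, this]
  simp

theorem Ad_one [LocallyConvexSpace ℝ E] [LCLieGroup E G] (y : E) : Ad (1 : G) y = y := by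
  obtain ⟨-, D, hD, hc⟩ := LCLieGroup.smooth_mul (E := E) (G := G) _ (chart_mem_atlas E 1) _
    (chart_mem_atlas E 1) _ (chart_mem_atlas E 1) 1
  have h := Ad_oneChart_symm_apply hD hc (oneCoord_mem_target (E := E) (G := G)) (by simp) y
  rwa [oneChart_symm_oneCoord, invCoord_oneCoord,
    deriv_mulCoord_right hD oneCoord_mem_target, deriv_mulCoord_left hD oneCoord_mem_target] at h

/-- The Lie bracket is the genuine derivative of the adjoint action, and it is the
antisymmetrization of the mixed second derivative `B` of the multiplication at `(1, 1)`. -/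
theorem exists_lieBr_eq_sub [LocallyConvexSpace ℝ E] [LCLieGroup E G] :
    ∃ B : E → E → E, ∀ y : E, ∃ A : E →L[ℝ] E,
      HasDerivLC (fun u : E => Ad ((oneChart E G).symm u) y) A (oneCoord E G) ∧
        ∀ v, A v = B v y - B y v := by
  obtain ⟨-, D, hD, hc, D', hD', hc'⟩ := LCLieGroup.smooth_mul (E := E) (G := G) _
    (chart_mem_atlas E 1) _ (chart_mem_atlas E 1) _ (chart_mem_atlas E 1) 2
  obtain ⟨-, I, hI, -⟩ := LCLieGroup.smooth_inv (E := E) (G := G) _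
    (chart_mem_atlas E 1) _ (chart_mem_atlas E 1) 1
  change ∀ q ∈ mulDomain E G, HasDerivLC (mulCoord E G) (D q) q at hD
  change ContinuousOn (fun r : (E × E) × (E × E) => D r.1 r.2)
    (mulDomain E G ×ˢ Set.univ) at hc
  change ∀ q ∈ mulDomain E G ×ˢ (Set.univ : Set (E × E)),
    HasDerivLC (fun r : (E × E) × (E × E) => D r.1 r.2) (D' q) q at hD'
  change ContinuousOn (fun r : ((E × E) × (E × E)) × ((E × E) × (E × E)) => D' r.1 r.2)
    ((mulDomain E G ×ˢ (Set.univ : Set (E × E))) ×ˢ Set.univ) at hc'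
  set e := oneCoord E G with he
  have het : e ∈ (oneChart E G).target := oneCoord_mem_target
  have ho : (e, e) ∈ mulDomain E G := mk_oneCoord_mem_mulDomain het
  have hoU : ∀ w : E × E, ((e, e), w) ∈ mulDomain E G ×ˢ (Set.univ : Set (E × E)) :=
    fun w => ⟨ho, trivial⟩
  have hIe : HasDerivLC (invCoord E G) (I e) e := hI e ⟨het, by simp [he]⟩
  have hev := eventually_inv_mem_source (E := E) (G := G)
  -- The derivative of the inversion at `1` is `-id`.
  have hIneg : ∀ v, I e v = -v := by
    intro v
    have hγ : Tendsto (fun s : ℝ => s⁻¹ • ((e + s • v, invCoord E G (e + s • v)) - (e, e)))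
        (𝓝[≠] 0) (𝓝 (v, I e v)) := by
      have h1 : Tendsto (fun s : ℝ => s⁻¹ • (e + s • v - e)) (𝓝[≠] 0) (𝓝 v) :=
        tendsto_const_nhds.congr' (by
          filter_upwards [self_mem_nhdsWithin] with s hs
          rw [add_sub_cancel_left, inv_smul_smul₀ hs])
      refine (h1.prodMk_nhds (hIe v)).congr fun s => ?_
      rw [invCoord_oneCoord]; rfl
    have h2 := tendsto_slope_comp isOpen_mulDomain hD hc ho hγ
    have h3 : D (e, e) (v, I e v) = 0 := by
      refine tendsto_nhds_unique h2 (tendsto_const_nhds.congr' ?_)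
      filter_upwards [nhdsWithin_le_nhds ((tendsto_add_smul_nhds_zero e v).eventually hev)]
        with s hs
      rw [mulCoord_mk_invCoord hs.2, mulCoord_mk_oneCoord het, sub_self, smul_zero]
    have h4 : (v, I e v) = (v, 0) + (0, I e v) := by simp
    rw [h4, map_add, deriv_mulCoord_left hD het, deriv_mulCoord_right hD het] at h3
    exact (neg_eq_of_add_eq_zero_right h3).symm
  have hleft : ∀ v y, D' ((e, e), (y, 0)) ((v, 0), (0, 0)) = 0 := by
    intro v y
    refine tendsto_nhds_unique (hD' _ (hoU _) _) (tendsto_const_nhds.congr' ?_)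
    filter_upwards [nhdsWithin_le_nhds ((tendsto_add_smul_nhds_zero e v).eventually hev)]
      with s hs
    have e1 : ((e, e), ((y, 0) : E × E)) + s • (((v, 0) : E × E), ((0, 0) : E × E)) =
      ((e + s • v, e), (y, 0)) := by simp
    rw [e1, deriv_mulCoord_left hD hs.1, deriv_mulCoord_left hD het, sub_self, smul_zero]
  have hlin : ∀ b y, D' ((e, e), (y, 0)) ((0, 0), (b, 0)) = b := by
    intro b y
    refine tendsto_nhds_unique (hD' _ (hoU _) _) (tendsto_const_nhds.congr' ?_)
    filter_upwards [self_mem_nhdsWithin] with s hs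
    have e1 : ((e, e), ((y, 0) : E × E)) + s • (((0, 0) : E × E), ((b, 0) : E × E)) =
      ((e, e), (y + s • b, 0)) := by simp
    rw [e1, deriv_mulCoord_left hD het, deriv_mulCoord_left hD het, add_sub_cancel_left,
      inv_smul_smul₀ hs]
  have hsymm : ∀ v y, D' ((e, e), (y, 0)) ((0, v), (0, 0)) =
      D' ((e, e), (0, v)) ((y, 0), (0, 0)) :=
    fun v y => second_deriv_symm isOpen_mulDomain hD hD' hc' ho (y, 0) (0, v)
  refine ⟨fun v y => D' ((e, e), (0, y)) ((v, 0), (0, 0)), fun y => ?_⟩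
  refine ⟨(D' ((e, e), (y, 0))).comp (((ContinuousLinearMap.id ℝ E).prod (I e)).prod
    (((D' ((e, e), (0, y))).comp (((ContinuousLinearMap.id ℝ E).prod 0).prod 0)).prod 0)),
    fun v => ?_, fun v => ?_⟩
  · have hγ : Tendsto (fun s : ℝ => s⁻¹ • (((e + s • v, invCoord E G (e + s • v)),
        (D (e + s • v, e) (0, y), (0 : E))) - ((e, e), (y, 0)))) (𝓝[≠] 0)
        (𝓝 ((v, I e v), (D' ((e, e), (0, y)) ((v, 0), (0, 0)), 0))) := by
      have h1 : Tendsto (fun s : ℝ => s⁻¹ • (e + s • v - e)) (𝓝[≠] 0) (𝓝 v) :=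
        tendsto_const_nhds.congr' (by
          filter_upwards [self_mem_nhdsWithin] with s hs
          rw [add_sub_cancel_left, inv_smul_smul₀ hs])
      have h2 := hD' _ (hoU (0, y)) ((v, 0), (0, 0))
      refine ((h1.prodMk_nhds (hIe v)).prodMk_nhds
        (h2.prodMk_nhds (tendsto_const_nhds (x := (0 : E))))).congr fun s => ?_
      have e2 : D (e, e) (0, y) = y := deriv_mulCoord_right hD het y
      have e3 : invCoord E G e = e := invCoord_oneCoord
      simp [e2, e3]
    have h3 := tendsto_slope_comp (isOpen_mulDomain.prod isOpen_univ) hD' hc' (hoU (y, 0)) hγ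
    refine h3.congr' ?_
    filter_upwards [nhdsWithin_le_nhds ((tendsto_add_smul_nhds_zero e v).eventually hev)]
      with s hs
    have h0 := hev.self_of_nhds
    rw [Ad_oneChart_symm_apply hD hc hs.1 hs.2, Ad_oneChart_symm_apply hD hc h0.1 h0.2,
      deriv_mulCoord_right hD het, invCoord_oneCoord]
  · simp only [ContinuousLinearMap.comp_apply, ContinuousLinearMap.prod_apply,
      ContinuousLinearMap.id_apply, zero_apply, hIneg]
    set b := D' ((e, e), (0, y)) ((v, 0), (0, 0)) with hb
    have hb' : D' ((e, e), (0, y)) ((v, 0), 0) = b := rfl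
    rw [hb']
    have e1 : (((v, -v), (b, 0)) : (E × E) × (E × E)) =
      ((v, 0), (0, 0)) - ((0, v), (0, 0)) + ((0, 0), (b, 0)) := by simp
    rw [e1, map_add, map_sub, hleft, hlin, hsymm]
    abel

variable [LocallyConvexSpace ℝ E] [LCLieGroup E G]

theorem hasDerivLC_Ad (y : E) :
    ∃ A : E →L[ℝ] E, HasDerivLC (fun u : E => Ad ((oneChart E G).symm u) y) A (oneCoord E G) ∧
      ∀ v, A v = lieBr G v y := by
  obtain ⟨B, hB⟩ := exists_lieBr_eq_sub (E := E) (G := G)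
  obtain ⟨A, hA, -⟩ := hB y
  exact ⟨A, hA, fun v => by rw [lieBr, hA.derivLC_eq]⟩

theorem tendsto_slope_Ad (v y : E) :
    Tendsto (fun s : ℝ => s⁻¹ • (Ad ((oneChart E G).symm (oneCoord E G + s • v)) y - y))
      (𝓝[≠] 0) (𝓝 (lieBr G v y)) := by
  obtain ⟨A, hA, hA'⟩ := hasDerivLC_Ad (G := G) y
  have := hA v
  simpa only [hA', oneChart_symm_oneCoord, Ad_one] using this

theorem lieBr_antisymm (x y : E) : lieBr G x y = -lieBr G y x := by
  obtain ⟨B, hB⟩ := exists_lieBr_eq_sub (E := E) (G := G)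
  have h : ∀ v y, lieBr G v y = B v y - B y v := fun v y => by
    obtain ⟨A, hA, hA'⟩ := hB y
    rw [← hA', lieBr, hA.derivLC_eq]
  rw [h, h, neg_sub]

theorem lieBr_self (x : E) : lieBr G x x = 0 := by
  obtain ⟨B, hB⟩ := exists_lieBr_eq_sub (E := E) (G := G)
  obtain ⟨A, hA, hA'⟩ := hB x
  rw [lieBr, hA.derivLC_eq, hA', sub_self]

variable (G) in
/-- `ad x = [x, ·]` as a linear map. -/
noncomputable def adLin (x : E) : E →ₗ[ℝ] E where
  toFun := lieBr G x
  map_add' y z := by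
    rw [lieBr_antisymm, lieBr_antisymm x y, lieBr_antisymm x z, lieBr, map_add, neg_add]
    rfl
  map_smul' c y := by
    rw [lieBr_antisymm, lieBr_antisymm x y, lieBr, map_smul, RingHom.id_apply, smul_neg]
    rfl

theorem adLin_apply (x y : E) : adLin G x y = lieBr G x y := rfl

end Derivatives
end GroupChart

/-! ### Open convex sets and skew-symmetric operators -/

section Convexity

open scoped InnerProductSpace

/-- Let `A` be an open convex subset of a Hilbert space and `J` a skew-symmetric operator that is
infinitesimally tangent to `A`: every normal vector `n` of `A` at a boundary point `y` is
orthogonal to `J y`. If `A` meets the range of `J`, then `0 ∈ A`. -/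
theorem zero_mem_of_skew_tangent {H : Type*} [NormedAddCommGroup H] [InnerProductSpace ℝ H]
    [CompleteSpace H] {A : Set H} (hAo : IsOpen A) (hAc : Convex ℝ A) (J : H →ₗ[ℝ] H)
    (hJ : ∀ u, ⟪u, J u⟫_ℝ = 0)
    (hN : ∀ y ∈ closure A, ∀ n : H, n ≠ 0 → (∀ a ∈ A, ⟪n, a⟫_ℝ ≤ ⟪n, y⟫_ℝ) → ⟪n, J y⟫_ℝ = 0)
    {w : H} (hw : J w ∈ A) : (0 : H) ∈ A := by
  obtain ⟨ρ, hρ, hball⟩ := Metric.isOpen_iff.1 hAo _ hw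
  have key : ∀ τ : ℝ, τ ≠ 0 → |τ| * (2 * ‖w‖) < ρ → τ • w ∈ A := by
    intro τ hτ hτρ
    by_contra hu
    -- A boundary point `y` with a normal vector `n` pointing towards `τ • w`.
    obtain ⟨y, hy, n, hn, r, hr, huy, hsupp⟩ : ∃ y ∈ closure A, ∃ n : H, n ≠ 0 ∧
        ∃ r : ℝ, 0 ≤ r ∧ τ • w = y + r • n ∧ ∀ a ∈ A, ⟪n, a⟫_ℝ ≤ ⟪n, y⟫_ℝ := by
      by_cases hcl : τ • w ∈ closure A
      · obtain ⟨l, hl⟩ := geometric_hahn_banach_open_point hAc hAo hu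
        refine ⟨_, hcl, (InnerProductSpace.toDual ℝ H).symm l, ?_, 0, le_rfl, by simp, ?_⟩
        · intro h0
          have : l = 0 := by simpa using h0
          have := hl _ hw
          simp_all
        · intro a ha
          simpa using (hl a ha).le
      · obtain ⟨y, hy, hmin⟩ := exists_norm_eq_iInf_of_complete_convex ⟨_, subset_closure hw⟩
          isClosed_closure.isComplete hAc.closure (τ • w)
        rw [norm_eq_iInf_iff_real_inner_le_zero hAc.closure hy] at hmin
        refine ⟨y, hy, τ • w - y, fun h => hcl ?_, 1, zero_le_one, by simp, fun a ha => ?_⟩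
        · rwa [sub_eq_zero.1 h]
        · have := hmin a (subset_closure ha)
          rwa [inner_sub_right, sub_nonpos] at this
    have h1 : ⟪n, J w⟫_ℝ = 0 := by
      have h2 : ⟪n, J (τ • w)⟫_ℝ = 0 := by
        rw [huy, map_add, map_smul, inner_add_right, inner_smul_right, hJ, hN y hy n hn hsupp]
        simp
      rw [map_smul, inner_smul_right] at h2
      exact (mul_eq_zero.1 h2).resolve_left hτ
    have hnpos : 0 < ‖n‖ := norm_pos_iff.2 hn
    -- Test the support inequality at a point of the ball around `J w`.
    have h3 : J w + (ρ / 2 / ‖n‖) • n ∈ A := by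
      apply hball
      rw [Metric.mem_ball, dist_eq_norm, add_sub_cancel_left, norm_smul, Real.norm_eq_abs,
        abs_of_pos (by positivity), div_mul_cancel₀ _ hnpos.ne']
      linarith
    have h4 := hsupp _ h3
    rw [inner_add_right, h1, inner_smul_right, real_inner_self_eq_norm_sq] at h4
    have h5 : ⟪n, y⟫_ℝ ≤ ‖n‖ * (|τ| * ‖w‖) := by
      have e : y = τ • w - r • n := by rw [huy]; simp
      rw [e, inner_sub_right, inner_smul_right n n, real_inner_self_eq_norm_sq]
      have := real_inner_le_norm n (τ • w)
      rw [norm_smul, Real.norm_eq_abs] at this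
      nlinarith [mul_nonneg hr (sq_nonneg ‖n‖)]
    have h6 : ρ / 2 / ‖n‖ * ‖n‖ ^ 2 = ‖n‖ * (ρ / 2) := by field_simp
    rw [h6, zero_add] at h4
    have := le_of_mul_le_mul_left (h4.trans h5) hnpos
    linarith
  have hτ : 0 < ρ / (2 * ‖w‖ + 1) := by positivity
  have hlt : ρ / (2 * ‖w‖ + 1) * (2 * ‖w‖) < ρ := by
    rw [div_mul_eq_mul_div, div_lt_iff₀ (by positivity)]
    nlinarith
  have hp := key _ hτ.ne' (by rwa [abs_of_pos hτ])
  have hm := key (-(ρ / (2 * ‖w‖ + 1))) (neg_ne_zero.2 hτ.ne') (by rwa [abs_neg, abs_of_pos hτ])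
  have := hAc hp hm (by norm_num : (0 : ℝ) ≤ 1 / 2) (by norm_num : (0 : ℝ) ≤ 1 / 2) (by norm_num)
  simpa using this

end Convexity

/-! ### Supporting functionals of invariant convex sets -/

section Planes

variable {E : Type*} [AddCommGroup E] [Module ℝ E] {ι : Type*}

/-- The real linear map `ζ ↦ ∑ i, Re (ζ i (a i + i b i))` into `E`. Its source carries the
Euclidean norm, so that it is a real Hilbert space. -/
def planeMap [Fintype ι] (a b : ι → E) : PiLp 2 (fun _ : ι => ℂ) →ₗ[ℝ] E where
  toFun ζ := ∑ i, ((ζ i).re • a i - (ζ i).im • b i)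
  map_add' ζ ξ := by
    rw [← Finset.sum_add_distrib]
    refine Finset.sum_congr rfl fun i _ => ?_
    simp only [PiLp.add_apply, Complex.add_re, Complex.add_im]
    module
  map_smul' r ζ := by
    rw [Finset.smul_sum]
    refine Finset.sum_congr rfl fun i _ => ?_
    simp only [PiLp.smul_apply, Complex.smul_re, Complex.smul_im, RingHom.id_apply, smul_eq_mul]
    module

/-- The infinitesimal rotation that multiplies the `i`-th coordinate by `√-1 μ i`. -/
def rotation (μ : ι → ℝ) : PiLp 2 (fun _ : ι => ℂ) →ₗ[ℝ] PiLp 2 (fun _ : ι => ℂ) where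
  toFun ζ := WithLp.toLp 2 fun i => ((μ i : ℂ) * Complex.I) * ζ i
  map_add' ζ ξ := by ext i; simp [mul_add]
  map_smul' r ζ := by ext i; simp; ring

end Planes

section Supporting

open scoped InnerProductSpace

variable {E : Type*} [AddCommGroup E] [Module ℝ E] [TopologicalSpace E]
  [IsTopologicalAddGroup E] [ContinuousSMul ℝ E] [LocallyConvexSpace ℝ E] [T2Space E]
  {G : Type*} [Group G] [TopologicalSpace G] [ChartedSpace E G] [LCLieGroup E G]

/-- A functional that supports an invariant set at `y` vanishes on `[𝔤, y]`, because
`g ↦ l (Ad(g) y)` is maximal at `1`. -/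
theorem apply_lieBr_eq_zero {O : Set E} (hinv : AdInvariant G (closure O)) (h : E) {y : E}
    (hy : y ∈ closure O) (l : E →L[ℝ] ℝ) (hl : ∀ x ∈ O, l x ≤ l y) : l (lieBr G h y) = 0 := by
  have hl' : ∀ x ∈ closure O, l x ≤ l y :=
    fun x hx => closure_minimal hl (isClosed_le l.continuous continuous_const) hx
  have ht := (l.continuous.tendsto _).comp (tendsto_slope_Ad (G := G) h y)
  have hle : ∀ s : ℝ, l (Ad ((oneChart E G).symm (oneCoord E G + s • h)) y - y) ≤ 0 := by
    intro s
    rw [map_sub, sub_nonpos]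
    exact hl' _ (hinv _ _ hy)
  apply le_antisymm
  · refine le_of_tendsto (ht.mono_left (nhdsGT_le_nhdsNE 0)) ?_
    filter_upwards [self_mem_nhdsWithin] with s hs
    simp only [Function.comp, map_smul, smul_eq_mul]
    exact mul_nonpos_of_nonneg_of_nonpos (inv_nonneg.2 (le_of_lt hs)) (hle s)
  · refine ge_of_tendsto (ht.mono_left (nhdsLT_le_nhdsNE 0)) ?_
    filter_upwards [self_mem_nhdsWithin] with s hs
    simp only [Function.comp, map_smul, smul_eq_mul]
    exact mul_nonneg_of_nonpos_of_nonpos (inv_nonpos.2 (le_of_lt hs)) (hle s)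

/-- If `[h, z] = 0` and the pairs `(a i, b i)` span planes on which `ad h` acts as an infinitesimal
rotation of speed `μ i ≠ 0`, then an invariant open convex set that contains a point of
`z + ∑ i, ℝ a i + ℝ b i` contains `z`. -/
theorem mem_of_add_sum_mem {O : Set E} (hOo : IsOpen O) (hOc : Convex ℝ O)
    (hinv : AdInvariant G (closure O)) {ι : Type*} [Fintype ι] {h z : E} {a b : ι → E} {μ : ι → ℝ}
    (hz : lieBr G h z = 0) (hμ : ∀ i, μ i ≠ 0) (ha : ∀ i, lieBr G h (a i) = -(μ i • b i))
    (hb : ∀ i, lieBr G h (b i) = μ i • a i) (c : ι → ℂ)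
    (hc : z + ∑ i, ((c i).re • a i - (c i).im • b i) ∈ O) : z ∈ O := by
  set Φ := planeMap a b
  set J := rotation μ
  have hΦJ : ∀ ζ, lieBr G h (z + Φ ζ) = Φ (J ζ) := by
    intro ζ
    change adLin G h (z + ∑ i, ((ζ i).re • a i - (ζ i).im • b i)) =
      ∑ i, ((((μ i : ℂ) * Complex.I) * ζ i).re • a i -
        (((μ i : ℂ) * Complex.I) * ζ i).im • b i)
    rw [map_add, adLin_apply, hz, zero_add, map_sum]
    refine Finset.sum_congr rfl fun i _ => ?_
    rw [map_sub, map_smul, map_smul, adLin_apply, adLin_apply, ha, hb]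
    simp only [Complex.mul_re, Complex.mul_im, Complex.ofReal_re, Complex.ofReal_im,
      Complex.I_re, Complex.I_im]
    module
  have hΦc : Continuous fun ζ : PiLp 2 (fun _ : ι => ℂ) => z + Φ ζ :=
    continuous_const.add Φ.continuous_of_finiteDimensional
  let A : Set (PiLp 2 (fun _ : ι => ℂ)) := (fun ζ => z + Φ ζ) ⁻¹' O
  have hAo : IsOpen A := hOo.preimage hΦc
  have hAc : Convex ℝ A := (hOc.translate_preimage_right z).linear_preimage Φ
  have hcA : WithLp.toLp 2 c ∈ A := hc
  suffices (0 : PiLp 2 (fun _ : ι => ℂ)) ∈ A by simpa [A] using this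
  have hJw : J (WithLp.toLp 2 fun i => c i / ((μ i : ℂ) * Complex.I)) = WithLp.toLp 2 c := by
    ext i
    have : (μ i : ℂ) * Complex.I ≠ 0 :=
      mul_ne_zero (Complex.ofReal_ne_zero.2 (hμ i)) Complex.I_ne_zero
    exact mul_div_cancel₀ _ this
  refine zero_mem_of_skew_tangent hAo hAc J ?_ ?_ (hJw ▸ hcA)
  · intro ζ
    rw [PiLp.inner_apply]
    refine Finset.sum_eq_zero fun i _ => ?_
    simp [J, rotation, Complex.inner]
    ring
  · intro y hy n hn hsupp
    have hyO : z + Φ y ∈ closure O := 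
      map_mem_closure (f := fun ζ => z + Φ ζ) hΦc hy fun _ hx => hx
    -- The image of the half-space beyond the supporting hyperplane of `A` misses `O`.
    let M : Set E := (fun u => z + Φ u) '' {u | ⟪n, y⟫_ℝ ≤ ⟪n, u⟫_ℝ}
    have hMc : Convex ℝ M := by
      have h1 : Convex ℝ {u | ⟪n, y⟫_ℝ ≤ ⟪n, u⟫_ℝ} :=
        convex_halfSpace_ge ⟨inner_add_right n, fun r u => inner_smul_right n u r⟩ _
      have h2 := (h1.linear_image Φ).translate z
      rwa [Set.image_image] at h2
    have hdisj : Disjoint O M := by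
      rw [Set.disjoint_left]
      rintro _ huO ⟨u, hu, rfl⟩
      obtain ⟨ε, hε, hball⟩ := Metric.isOpen_iff.1 hAo u huO
      have hnpos : 0 < ‖n‖ := norm_pos_iff.2 hn
      have hmem : u + (ε / 2 / ‖n‖) • n ∈ A := by
        apply hball
        rw [Metric.mem_ball, dist_eq_norm, add_sub_cancel_left, norm_smul, Real.norm_eq_abs,
          abs_of_pos (by positivity), div_mul_cancel₀ _ hnpos.ne']
        linarith
      have h1 := hsupp _ hmem
      rw [inner_add_right, inner_smul_right, real_inner_self_eq_norm_sq] at h1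
      have h2 : 0 < ε / 2 / ‖n‖ * ‖n‖ ^ 2 := by positivity
      have h3 : ⟪n, y⟫_ℝ ≤ ⟪n, u⟫_ℝ := hu
      linarith
    obtain ⟨l, m, hlO, hlM⟩ := geometric_hahn_banach_open hOc hOo hMc hdisj
    have hym : l (z + Φ y) = m := by
      refine le_antisymm ?_ (hlM _ ⟨y, le_refl (inner ℝ n y), rfl⟩)
      exact closure_minimal (fun x hx => (hlO x hx).le)
        (isClosed_le l.continuous continuous_const) hyO
    have hlJ : l (Φ (J y)) = 0 := by
      rw [← hΦJ]
      exact apply_lieBr_eq_zero hinv h hyO l fun x hx => hym ▸ (hlO x hx).le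
    by_contra hne
    -- Otherwise `l ∘ Φ` would be nonnegative, hence zero.
    have hnonneg : ∀ d, 0 ≤ l (Φ d) := by
      intro d
      have h1 := hlM _ ⟨y + (d + (-⟪n, d⟫_ℝ / ⟪n, J y⟫_ℝ) • J y), by
        rw [Set.mem_ofPred_eq, inner_add_right, inner_add_right, inner_smul_right,
          div_mul_cancel₀ _ hne]
        linarith, rfl⟩
      simp only [map_add, map_smul, hlJ, smul_zero, add_zero] at h1 hym
      linarith
    have h1 := hlO _ hcA
    simp only [map_add] at h1 hym
    have h2 := hnonneg (WithLp.toLp 2 c - y)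
    simp only [map_sub] at h2
    linarith

end Supporting

/-! ### Root decompositions and the projection onto the Cartan subalgebra -/

section RealParts

variable {E : Type*} [AddCommGroup E] [Module ℝ E]

theorem sum_re {n : ℕ} (f : Fin n → Cplx E) : (∑ i, f i).re = ∑ i, (f i).re :=
  map_sum (⟨⟨Cplx.re, Cplx.re_zero⟩, Cplx.re_add⟩ : Cplx E →+ E) f _

variable {t : Submodule ℝ E}

/-- An element of `𝔱`, regarded as an element of `𝔱_ℂ`. -/
def realElt (h : t) : cplxSub t := ⟨Cplx.mk h 0, h.2, t.zero_mem⟩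

/-- The real linear functional `h ↦ Im α(h)` on `𝔱`. -/
def imPart (α : cplxSub t →ₗ[ℂ] ℂ) : Module.Dual ℝ t where
  toFun h := (α (realElt h)).im
  map_add' h k := by
    have : realElt (h + k) = realElt h + realElt k :=
      Subtype.ext (Cplx.ext rfl (add_zero (0 : E)).symm)
    rw [this, map_add, Complex.add_im]
  map_smul' r h := by
    have : realElt (r • h) = (r : ℂ) • realElt h := by
      refine Subtype.ext (Cplx.ext ?_ ?_)
      · change r • (h : E) = (r : ℂ).re • (h : E) - (r : ℂ).im • (0 : E)
        simp
      · change (0 : E) = (r : ℂ).re • (0 : E) + (r : ℂ).im • (h : E)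
        simp
    rw [this, map_smul]
    simp

variable [TopologicalSpace E] {G : Type*} [Group G] [TopologicalSpace G] [ChartedSpace E G]

theorem lieBr_re_im_of_mem_rootSpace {α : cplxSub t →ₗ[ℂ] ℂ} {z : Cplx E}
    (hz : z ∈ rootSpace G t α) (h : t) (hre : (α (realElt h)).re = 0) :
    lieBr G (h : E) z.re = -(imPart α h • z.im) ∧ lieBr G (h : E) z.im = imPart α h • z.re := by
  have h0 : ∀ x, lieBr G (0 : E) x = 0 := fun x => by rw [lieBr, map_zero]
  have h1 := congrArg Cplx.re (hz (realElt h))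
  have h2 := congrArg Cplx.im (hz (realElt h))
  simp only [lieBrC, realElt, Cplx.re_mk, Cplx.im_mk, Cplx.re_smul, Cplx.im_smul, h0] at h1 h2
  change (α ⟨Cplx.mk (h : E) 0, _⟩).re = 0 at hre
  rw [hre] at h1 h2
  have h3 : imPart α h = (α ⟨Cplx.mk (h : E) 0, h.2, t.zero_mem⟩).im := rfl
  rw [h3]
  exact ⟨by simpa using h1, by simpa using h2⟩

theorem exists_imPart_ne_zero (ht : IsEllipticCartan G t) {α : cplxSub t →ₗ[ℂ] ℂ}
    (hα : IsRoot G t α) : ∃ h : t, imPart α h ≠ 0 := by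
  by_contra! hcon
  refine hα.1 (LinearMap.ext fun h => ?_)
  have hzero : ∀ k : t, α (realElt k) = 0 := fun k =>
    Complex.ext (ht.root_imaginary α hα _ rfl) (hcon k)
  have hdec : h = realElt ⟨_, h.2.1⟩ + Complex.I • realElt ⟨_, h.2.2⟩ := by
    refine Subtype.ext (Cplx.ext ?_ ?_) <;> simp [realElt]
  rw [hdec, map_add, map_smul, hzero, hzero]
  simp

theorem AdInvariant.closure {C : Set E} (hC : AdInvariant G C) : AdInvariant G (closure C) :=
  fun g _ hx => map_mem_closure (Ad g).continuous hx fun y hy => hC g y hy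

end RealParts

section Cartan

variable {E : Type*} [AddCommGroup E] [Module ℝ E] [TopologicalSpace E]
  [IsTopologicalAddGroup E] [ContinuousSMul ℝ E] [LocallyConvexSpace ℝ E] [T2Space E]
  {G : Type*} [Group G] [TopologicalSpace G] [ChartedSpace E G] [LCLieGroup E G]
  {t : Submodule ℝ E}

/-- A maximal abelian subalgebra is its own centralizer. -/
theorem mem_of_forall_lieBr_eq_zero (ht : Maximal (IsAbelianSubalgebra G) t) {x : E}
    (hx : ∀ h ∈ t, lieBr G h x = 0) : x ∈ t := by
  have hab : IsAbelianSubalgebra G (t ⊔ Submodule.span ℝ {x}) := by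
    intro u hu v hv
    obtain ⟨h, hh, u', hu', rfl⟩ := Submodule.mem_sup.1 hu
    obtain ⟨k, hk, v', hv', rfl⟩ := Submodule.mem_sup.1 hv
    obtain ⟨r, rfl⟩ := Submodule.mem_span_singleton.1 hu'
    obtain ⟨s, rfl⟩ := Submodule.mem_span_singleton.1 hv'
    have h1 : ∀ w, lieBr G (h + r • x) w = lieBr G h w + r • lieBr G x w := fun w => by
      simp only [lieBr, map_add, map_smul]
    rw [h1, ← adLin_apply, ← adLin_apply]
    simp only [map_add, map_smul, adLin_apply]
    rw [ht.prop h hh k hk, hx h hh, lieBr_antisymm x k, hx k hk, lieBr_self]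
    simp
  exact ht.le_of_ge hab le_sup_left (Submodule.mem_sup_right (Submodule.mem_span_singleton_self x))

variable {p : E →L[ℝ] t}

/-- Invariant open convex sets are stable under `p` on the real parts of sums of root vectors. -/
theorem map_mem_of_mem_span (ht : IsEllipticCartan G t) (hp_proj : ∀ x : t, p (x : E) = x)
    (hp_equiv : ∀ h ∈ t, ∀ x : E, (p (lieBr G h x) : E) = lieBr G h (p x : E))
    {O : Set E} (hOo : IsOpen O) (hOc : Convex ℝ O) (hinv : AdInvariant G (closure O))
    {Z : Cplx E}
    (hZ : Z ∈ Submodule.span ℂ (⋃ α : cplxSub t →ₗ[ℂ] ℂ, rootSpace G t α))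
    (τ : t) (hO : Z.re + τ ∈ O) : (p (Z.re + τ) : E) ∈ O := by
  classical
  obtain ⟨n, f, g, rfl⟩ := Submodule.mem_span_set'.1 hZ
  have hg : ∀ i, ∃ α : cplxSub t →ₗ[ℂ] ℂ, (g i : Cplx E) ∈ rootSpace G t α :=
    fun i => Set.mem_iUnion.1 (g i).2
  choose α hα using hg
  have hcomm : ∀ h ∈ t, ∀ k ∈ t, lieBr G h k = 0 := ht.maximal_abelian.prop
  let Q : Fin n → Prop := fun i => α i ≠ 0 ∧ (g i : Cplx E) ≠ 0
  have hroot : ∀ i, Q i → IsRoot G t (α i) := fun i hi => ⟨hi.1, _, hα i, hi.2⟩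
  have hbr : ∀ i, Q i → ∀ h : t,
      lieBr G (h : E) (g i : Cplx E).re = -(imPart (α i) h • (g i : Cplx E).im) ∧
      lieBr G (h : E) (g i : Cplx E).im = imPart (α i) h • (g i : Cplx E).re :=
    fun i hi h => lieBr_re_im_of_mem_rootSpace (hα i) h (ht.root_imaginary _ (hroot i hi) _ rfl)
  have hmem : ∀ i, ¬ Q i → (g i : Cplx E).re ∈ t ∧ (g i : Cplx E).im ∈ t := by
    intro i hi
    by_cases h0 : α i = 0
    · have h1 : ∀ h : t, lieBr G (h : E) (g i : Cplx E).re = 0 ∧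
          lieBr G (h : E) (g i : Cplx E).im = 0 := by
        intro h
        have := lieBr_re_im_of_mem_rootSpace (hα i) h (by simp [h0])
        simpa [imPart, h0] using this
      exact ⟨mem_of_forall_lieBr_eq_zero ht.maximal_abelian fun h hh => (h1 ⟨h, hh⟩).1,
        mem_of_forall_lieBr_eq_zero ht.maximal_abelian fun h hh => (h1 ⟨h, hh⟩).2⟩
    · have h1 : (g i : Cplx E) = 0 := by
        by_contra h2
        exact hi ⟨h0, h2⟩
      rw [h1]
      exact ⟨t.zero_mem, t.zero_mem⟩
  have hker : ∀ i, Q i → p (g i : Cplx E).re = 0 ∧ p (g i : Cplx E).im = 0 := by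
    intro i hi
    obtain ⟨h, hh⟩ := exists_imPart_ne_zero ht (hroot i hi)
    have key : ∀ x y : E, lieBr G (h : E) x = imPart (α i) h • y → p y = 0 := by
      intro x y hxy
      have h1 := hp_equiv h h.2 x
      rw [hxy, hcomm h h.2 _ (p x).2, map_smul] at h1
      have h2 : imPart (α i) h • p y = 0 := Subtype.ext h1
      exact (smul_eq_zero.1 h2).resolve_left hh
    refine ⟨key _ _ (hbr i hi h).2, ?_⟩
    have h3 := key (g i : Cplx E).re (-(g i : Cplx E).im) (by rw [(hbr i hi h).1, smul_neg])
    rwa [map_neg, neg_eq_zero] at h3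
  -- A regular element `h`, on which no root that occurs in the sum vanishes.
  obtain ⟨h, hh⟩ := Module.Dual.exists_forall_ne_zero_of_forall_exists
    (fun i : {i // Q i} => imPart (α i)) fun i => exists_imPart_ne_zero ht (hroot i i.2)
  let F : Fin n → E := fun i =>
    (f i).re • (g i : Cplx E).re - (f i).im • (g i : Cplx E).im
  let z : E := τ + ∑ i : {i // ¬ Q i}, F i
  have hzt : z ∈ t := t.add_mem τ.2 (t.sum_mem fun i _ =>
    t.sub_mem (t.smul_mem _ (hmem i i.2).1) (t.smul_mem _ (hmem i i.2).2))
  have hx : (∑ i, f i • (g i : Cplx E)).re + (τ : E) = z + ∑ i : {i // Q i}, F i := by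
    have h1 : (∑ i, f i • (g i : Cplx E)).re = ∑ i, F i := by
      rw [sum_re]; rfl
    rw [h1, ← Fintype.sum_subtype_add_sum_subtype Q F]
    simp only [z]
    abel
  have hpz : (p (z + ∑ i : {i // Q i}, F i) : E) = z := by
    have h1 : p (∑ i : {i // Q i}, F i) = 0 := by
      rw [map_sum]
      refine Finset.sum_eq_zero fun i _ => ?_
      rw [map_sub, map_smul, map_smul, (hker i i.2).1, (hker i i.2).2, smul_zero, smul_zero,
        sub_zero]
    rw [map_add, h1, add_zero]
    exact congrArg Subtype.val (hp_proj ⟨z, hzt⟩)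
  rw [hx, hpz]
  rw [hx] at hO
  exact mem_of_add_sum_mem (G := G) hOo hOc hinv (h := h) (hcomm h h.2 z hzt) hh
    (fun i => (hbr i i.2 h).1) (fun i => (hbr i i.2 h).2) (fun i => f i) hO

/-- The projection `p` maps an open convex set with invariant closure into itself. -/
theorem map_mem_of_mem (ht : IsEllipticCartan G t) (hp_proj : ∀ x : t, p (x : E) = x)
    (hp_equiv : ∀ h ∈ t, ∀ x : E, (p (lieBr G h x) : E) = lieBr G h (p x : E))
    {O : Set E} (hOo : IsOpen O) (hOc : Convex ℝ O) (hinv : AdInvariant G (closure O))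
    {x : E} (hx : x ∈ O) : (p x : E) ∈ O := by
  -- Approximate `x` by the real part of a sum of root vectors, and correct it by an element of
  -- `t` so that the image under `p` does not change.
  have hcont : Continuous fun Z : Cplx E => Z.re + ((-p (Z.re - x) : t) : E) := by
    have hre : Continuous (Cplx.re : Cplx E → E) := continuous_fst
    fun_prop
  have hopen := hOo.preimage hcont
  obtain ⟨Z, hZO, hZ⟩ := ht.dense_span.inter_open_nonempty _ hopen ⟨Cplx.mk x 0, by simpa using hx⟩
  have := map_mem_of_mem_span ht hp_proj hp_equiv hOo hOc hinv hZ _ hZO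
  simpa [hp_proj] using this

end Cartan

/-! ### Convex sets in the dual -/

section Dual

variable {E : Type*} [AddCommGroup E] [Module ℝ E] [TopologicalSpace E]

/-- A weak-* closed convex set is separated from a point outside it by an evaluation. -/
theorem exists_lt_apply_of_notMem {C : Set (WeakDual ℝ E)} [ContinuousAdd E]
    [ContinuousConstSMul ℝ E] (hC : IsClosed C) (hconv : Convex ℝ C)
    {l : WeakDual ℝ E} (hl : l ∉ C) : ∃ (v : E) (c : ℝ), (∀ l' ∈ C, l' v < c) ∧ c < l v := by
  have : LocallyConvexSpace ℝ (WeakDual ℝ E) := WeakBilin.locallyConvexSpace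
  obtain ⟨f, c, hf, hc⟩ := geometric_hahn_banach_closed_point hconv hC hl
  obtain ⟨v, rfl⟩ := LinearMap.dualEmbedding_surjective (topDualPairing ℝ E) f
  exact ⟨v, c, hf, hc⟩

end Dual

end LCLie

theorem theorem3p10
    {E : Type*} [AddCommGroup E] [Module ℝ E] [TopologicalSpace E] [IsTopologicalAddGroup E]
    [ContinuousSMul ℝ E] [LocallyConvexSpace ℝ E] [T2Space E]
    {G : Type*} [Group G] [TopologicalSpace G] [ChartedSpace E G] [LCLie.LCLieGroup E G]
    [ConnectedSpace G]
    (t : Submodule ℝ E) (ht : LCLie.IsEllipticCartan G t)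
    (p : E →L[ℝ] t) (hp_proj : ∀ x : t, p (x : E) = x)
    (hp_equiv : ∀ h ∈ t, ∀ x : E, (p (LCLie.lieBr G h x) : E) = LCLie.lieBr G h (p x : E)) :
    (∀ C : Set E, IsOpen C → Convex ℝ C → LCLie.AdInvariant G C →
      p '' C = {x : t | (x : E) ∈ C}) ∧
    (∀ C : Set (WeakDual ℝ E), LCLie.SemiEquicontinuous C → IsClosed C → Convex ℝ C →
      LCLie.CoadInvariant G C →
      LCLie.dualMap t.subtypeL '' C = {m : WeakDual ℝ t | LCLie.dualMap p m ∈ C}) := by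
  refine ⟨fun C hCo hCc hCi => Set.Subset.antisymm ?_ fun x hx => ⟨x, hx, hp_proj x⟩,
    fun C hCs hCcl hCc hCi => Set.Subset.antisymm ?_ fun m hm => ⟨_, hm, ?_⟩⟩
  · rintro _ ⟨x, hx, rfl⟩
    exact LCLie.map_mem_of_mem ht hp_proj hp_equiv hCo hCc hCi.closure hx
  · rintro _ ⟨l, hl, rfl⟩
    by_contra hnot
    obtain ⟨v, c, hvC, hcv⟩ := LCLie.exists_lt_apply_of_notMem hCcl hCc hnot
    change c < l ((p v : t) : E) at hcv
    obtain ⟨U, hUo, ⟨v₀, hv₀⟩, M, hM⟩ := hCs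
    have hUM : ∀ u ∈ U, ∀ l' ∈ C, l' u ≤ M := fun u hu l' hl' =>
      EReal.coe_le_coe_iff.1 ((le_iSup₂ (f := fun (l : WeakDual ℝ E) (_ : l ∈ C) =>
        ((l u : ℝ) : EReal)) l' hl').trans (hM u hu))
    -- The point `(1 - ε) v + ε v₀` is interior to a sublevel set of the support functional.
    have key : ∀ ε ∈ Set.Ioo (0 : ℝ) 1,
        l ((p ((1 - ε) • v + ε • v₀) : t) : E) ≤ (1 - ε) * c + ε * M := by
      intro ε hε
      let K : Set E := {u | ∀ l' ∈ C, l' u ≤ (1 - ε) * c + ε * M}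
      have hKeq : K = ⋂ l' ∈ C, {u | l' u ≤ (1 - ε) * c + ε * M} := by ext; simp [K]
      have hKcl : IsClosed K := by
        rw [hKeq]
        exact isClosed_biInter fun l' _ =>
          isClosed_le (WeakDual.toStrongDual l').continuous continuous_const
      have hKc : Convex ℝ K := by
        rw [hKeq]
        exact convex_iInter₂ fun l' _ =>
          convex_halfSpace_le (WeakDual.toStrongDual l').toLinearMap.isLinear _
      have hKi : LCLie.AdInvariant G K := by
        intro g u hu l' hl'
        have := hu _ (hCi g⁻¹ l' hl')
        rwa [inv_inv] at this
      have hint : (1 - ε) • v + ε • v₀ ∈ interior K := by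
        refine mem_interior.2 ⟨(fun u => ε⁻¹ • (u - (1 - ε) • v)) ⁻¹' U, ?_,
          hUo.preimage (by fun_prop), ?_⟩
        · intro u hu l' hl'
          have h1 := hUM _ hu l' hl'
          have h2 := (hvC l' hl').le
          have e : u = (1 - ε) • v + ε • (ε⁻¹ • (u - (1 - ε) • v)) := by
            rw [smul_inv_smul₀ hε.1.ne']; abel
          rw [e, map_add, map_smul, map_smul, smul_eq_mul, smul_eq_mul]
          exact add_le_add (mul_le_mul_of_nonneg_left h2 (by linarith [hε.2]))
            (mul_le_mul_of_nonneg_left h1 hε.1.le)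
        · rw [Set.mem_preimage, add_sub_cancel_left, inv_smul_smul₀ hε.1.ne']
          exact hv₀
      have hcl : closure (interior K) = K := by
        rw [hKc.closure_interior_eq_closure_of_nonempty_interior ⟨_, hint⟩, hKcl.closure_eq]
      exact interior_subset (LCLie.map_mem_of_mem (G := G) ht hp_proj hp_equiv isOpen_interior
        hKc.interior (hcl.symm ▸ hKi) hint) l hl
    have hlim : Tendsto (fun ε : ℝ => l ((p ((1 - ε) • v + ε • v₀) : t) : E)) (𝓝[>] 0)
        (𝓝 (l ((p v : t) : E))) := by
      have : Continuous fun ε : ℝ => l ((p ((1 - ε) • v + ε • v₀) : t) : E) :=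
        (WeakDual.toStrongDual l).continuous.comp (by fun_prop)
      simpa using (this.tendsto 0).mono_left (nhdsWithin_le_nhds (s := Set.Ioi 0))
    have hlim' : Tendsto (fun ε : ℝ => (1 - ε) * c + ε * M) (𝓝[>] 0) (𝓝 c) := by
      have : Continuous fun ε : ℝ => (1 - ε) * c + ε * M := by fun_prop
      simpa using (this.tendsto 0).mono_left (nhdsWithin_le_nhds (s := Set.Ioi 0))
    exact absurd (le_of_tendsto_of_tendsto hlim hlim'
      (by filter_upwards [Ioo_mem_nhdsGT zero_lt_one] with ε hε using key ε hε)) (not_le.2 hcv)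
  · refine ContinuousLinearMap.ext fun x => ?_
    change m (p (x : E)) = m x
    rw [hp_proj]
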